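/- Let $k$ be an algebraically closed field and let $Y$ be a projective curve over $k$ (a reduced closed subscheme of some projective space $\mathbb{P}^n_k$ all of whose irreducible components have dimension $1$; $Y$ need be neither irreducible nor connected) with only simple nodes as singularities: for every closed point $y\in Y$, either the local ring $\mathcal{O}_{Y,y}$ is regular, or its completion $\widehat{\mathcal{O}}_{Y,y}$ is isomorphic as a $k$-algebra to $k[[x_0,x_1]]/(x_0x_1)$. Let $\mathrm{vect}\,Y$ be the category of vector bundles on $Y$, that is, the full subcategory of the category of sheaves of $\mathcal{O}_Y$-modules whose objects are the sheaves that are locally free, locally of finite rank. Let $\mathbf{K}[\mathrm{vect}\,Y]$ be its unbounded homotopy category: the objects are the $\mathbb{Z}$-indexed cochain complexes of vector bundles on $Y$, and the morphisms are the homotopy classes of cochain maps. Then every idempotent in $\mathbf{K}[\mathrm{vect}\,Y]$ splits: for every object $E$ and every morphism $e:E\to E$ in $\mathbf{K}[\mathrm{vect}\,Y]$ with $e\circ e=e$, there are an object $F$ and morphisms $i:F\to E$ and $p:E\to F$ in $\mathbf{K}[\mathrm{vect}\,Y]$ with $p\circ i=\mathrm{id}_F$ and $i\circ p=e$. -/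

import Mathlib

open AlgebraicGeometry CategoryTheory

universe u

namespace NodalCurve

noncomputable section

/-! ### Projective space and projective schemes over a field -/

attribute [local instance] MvPolynomial.gradedAlgebra

/-- Projective `n`-space over `k`, i.e. `Proj k[x₀, …, xₙ]` with the grading by degree. -/
def projSpace (k : Type u) [Field k] (n : ℕ) : Scheme.{u} :=
  Proj (MvPolynomial.homogeneousSubmodule (Fin (n + 1)) k)

/-- The structure morphism of projective `n`-space over `k`. -/
def projSpaceToSpec (k : Type u) [Field k] (n : ℕ) : projSpace k n ⟶ Spec (.of k) :=
  Proj.toSpecZero (MvPolynomial.homogeneousSubmodule (Fin (n + 1)) k) ≫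
    Spec.map (CommRingCat.ofHom
      (algebraMap k (MvPolynomial.homogeneousSubmodule (Fin (n + 1)) k 0)))

/-- A `k`-scheme `f : Y ⟶ Spec k` is projective if it admits a closed immersion over `k` into some
projective space over `k`. -/
def IsProjective {k : Type u} [Field k] {Y : Scheme.{u}} (f : Y ⟶ Spec (.of k)) : Prop :=
  ∃ (n : ℕ) (i : Y ⟶ projSpace k n), IsClosedImmersion i ∧ i ≫ projSpaceToSpec k n = f

/-! ### Curves with simple nodes -/

/-- A projective curve over `k`: a projective, reduced `k`-scheme all of whose irreducible
components have dimension one. It need be neither irreducible nor connected. -/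
structure IsProjectiveCurve {k : Type u} [Field k] {Y : Scheme.{u}} (f : Y ⟶ Spec (.of k)) :
    Prop where
  isProjective : IsProjective f
  isReduced : IsReduced Y
  dim_eq_one : ∀ Z ∈ irreducibleComponents Y, topologicalKrullDim Z = 1

/-- The structure map from `k` to the local ring of a `k`-scheme at a point. -/
def toStalk {k : Type u} [Field k] {Y : Scheme.{u}} (f : Y ⟶ Spec (.of k)) (y : Y) :
    k →+* Y.presheaf.stalk y :=
  ((Scheme.ΓSpecIso (.of k)).inv ≫ f.appTop ≫ Y.presheaf.germ ⊤ y trivial).hom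

/-- The point `y` of the `k`-scheme `Y` is a simple node (an ordinary double point): the completed
local ring at `y` is isomorphic, as a `k`-algebra, to `k⟦x₀, x₁⟧ / (x₀ x₁)`. -/
def IsSimpleNode {k : Type u} [Field k] {Y : Scheme.{u}} (f : Y ⟶ Spec (.of k)) (y : Y) : Prop :=
  letI : Algebra k (Y.presheaf.stalk y) := (toStalk f y).toAlgebra
  Nonempty
    (AdicCompletion (IsLocalRing.maximalIdeal (Y.presheaf.stalk y)) (Y.presheaf.stalk y) ≃ₐ[k]
      (MvPowerSeries (Fin 2) k ⧸
        Ideal.span {(MvPowerSeries.X 0 * MvPowerSeries.X 1 : MvPowerSeries (Fin 2) k)}))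

/-- The only singularities of the `k`-scheme `Y` are simple nodes: every closed point is either
regular or a simple node. -/
def HasOnlySimpleNodes {k : Type u} [Field k] {Y : Scheme.{u}} (f : Y ⟶ Spec (.of k)) : Prop :=
  ∀ y : Y, IsClosed {y} → IsRegularLocalRing (Y.presheaf.stalk y) ∨ IsSimpleNode f y

/-! ### Vector bundles -/

/-- A sheaf of modules is a vector bundle if every point has an open neighbourhood `U` on which it
is isomorphic to `𝒪_U ^ n` for some natural number `n` (which may depend on the point). -/
def isVectorBundle (Y : Scheme.{u}) : ObjectProperty Y.Modules := fun V =>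
  ∀ y : Y, ∃ (U : Y.Opens) (n : ℕ), y ∈ U ∧
    Nonempty ((V.restrict U.ι : U.toScheme.Modules) ≅
      (SheafOfModules.free (ULift.{u} (Fin n)) : U.toScheme.Modules))

/-- The category of vector bundles on `Y`, a full subcategory of the sheaves of modules. -/
abbrev Vect (Y : Scheme.{u}) := (isVectorBundle Y).FullSubcategory

/-- The unbounded homotopy category of cochain complexes of vector bundles on `Y`: objects are
`ℤ`-indexed cochain complexes, morphisms are cochain maps up to homotopy. -/
abbrev KVect (Y : Scheme.{u}) := HomotopyCategory (Vect Y) (ComplexShape.up ℤ)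

end

end NodalCurve

/-! ### Fitting idempotents in a ring -/

section FittingIdempotent

/-! The point is to replace an idempotent up to homotopy by a strict idempotent of complexes. An
endomorphism of a vector bundle satisfies a characteristic polynomial over the global functions.
These are integral over `k`, so it also satisfies a monic polynomial over `k`; splitting off the
power of `X` in that polynomial yields a Fitting decomposition
(`isStronglyPiRegular_of_universallyClosed`).

Let a chain map `a` represent the homotopy idempotent `e`. Fitting idempotents commute with every
map intertwining the endomorphisms (`IsFittingIdempotent.naturality`), so those of the components of
`a` form a chain idempotent `p`. In an unbounded complex the nilpotency exponents may be unbounded,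
but `a p + (1 - p)` and `1 - a (1 - p)` are invertible degreewise, hence as chain maps, hence up to
homotopy. There `e` is idempotent, and this forces `e = p` (`eq_of_idempotent_of_isUnit`). Finally
`p` splits degreewise, because a retract of a vector bundle is a vector bundle
(`isVectorBundle_of_retract`). -/

/-- An element `a` of a ring is strongly `π`-regular if some power `a ^ m` is a multiple of
`a ^ (m + 1)` by an element commuting with `a`. -/
def IsStronglyPiRegular {R : Type*} [Ring R] (a : R) : Prop :=
  ∃ (m : ℕ) (b : R), Commute b a ∧ a ^ m = b * a ^ (m + 1)

/-- `p` is a Fitting idempotent of `a`: it commutes with `a`, which is invertible on the image of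
`p` and nilpotent on the complement. -/
structure IsFittingIdempotent {R : Type*} [Ring R] (a p : R) : Prop where
  idem : p * p = p
  comm : Commute p a
  inv : ∃ b, Commute b a ∧ Commute b p ∧ b * a * p = p
  nil : ∃ N, a ^ N * (1 - p) = 0

variable {R : Type*} [Ring R] {a p : R}

/-- Iterating the relation gives `a ^ m = b ^ j * a ^ (m + j)`. The case `j = m` shows that `b ^ m *
a ^ m` fixes `a ^ m`, which makes it the required idempotent. -/
theorem IsStronglyPiRegular.exists_isFittingIdempotent (h : IsStronglyPiRegular a) :
    ∃ p, IsFittingIdempotent a p := by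
  obtain ⟨m, b, hc, hm⟩ := h
  have key : ∀ j, a ^ m = b ^ j * a ^ (m + j) := by
    intro j
    induction j with
    | zero => simp
    | succ j ih =>
      have : a ^ (m + j) = b * a ^ (m + (j + 1)) := by
        rw [pow_add, hm, mul_assoc, ← pow_add, add_right_comm, add_assoc]
      rw [pow_succ, mul_assoc, ← this, ← ih]
  have hp : Commute (b ^ m) (a ^ m) := hc.pow_pow m m
  have hcb : Commute b (b ^ m * a ^ m) := ((Commute.refl b).pow_right m).mul_right (hc.pow_right m)
  have hca : Commute (b ^ m * a ^ m) a := (hc.pow_left m).mul_left ((Commute.refl a).pow_left m)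
  have h2 : a ^ m * (b ^ m * a ^ m) = a ^ m := by
    rw [← mul_assoc, ← hp.eq, mul_assoc, ← pow_add, ← key]
  refine ⟨b ^ m * a ^ m, ⟨?_, hca, ⟨b, hc, hcb, ?_⟩, m, ?_⟩⟩
  · rw [mul_assoc, h2]
  · rw [mul_assoc, ← hca.eq, mul_assoc, ← pow_succ, ← mul_assoc, (Commute.refl b).pow_right m |>.eq,
      mul_assoc, ← hm]
  · rw [mul_sub, mul_one, h2, sub_self]

namespace IsFittingIdempotent

theorem exists_pow_mul (h : IsFittingIdempotent a p) (n : ℕ) : ∃ b, Commute b (a ^ n) ∧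
    b * a ^ n = p := by
  obtain ⟨b, hba, hbp, hb⟩ := h.inv
  have key : (b * a) ^ n * p = p := by
    induction n with
    | zero => simp
    | succ n ih => rw [pow_succ, mul_assoc, hb, ih]
  refine ⟨b ^ n * p, (hba.pow_pow n n).mul_left (h.comm.pow_right n), ?_⟩
  rw [mul_assoc, (h.comm.pow_right n).eq, ← mul_assoc, ← hba.mul_pow, key]

/-- This and `isUnit_sub` express the Fitting property without an exponent, so that it can be
checked degree by degree on a complex. -/
theorem isUnit_add (h : IsFittingIdempotent a p) : IsUnit (a * p + (1 - p)) := by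
  obtain ⟨b, hba, hbp, hb⟩ := h.inv
  have hpp := h.idem
  have e₁ : b * p * (a * p) = p := by rw [mul_assoc, ← mul_assoc p, h.comm.eq, mul_assoc, hpp,
    ← mul_assoc, hb]
  have e₂ : a * p * (b * p) = p := by rw [mul_assoc, ← mul_assoc p, ← hbp.eq, mul_assoc, hpp,
    ← mul_assoc, ← hba.eq, hb]
  refine ⟨⟨_, b * p + (1 - p), ?_, ?_⟩, rfl⟩ <;>
  · simp only [add_mul, mul_add, mul_sub, sub_mul, mul_one, one_mul, e₁, e₂, hpp]
    simp only [mul_assoc, hpp]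
    simp only [← mul_assoc, h.comm.eq, ← hbp.eq]
    simp only [mul_assoc, hpp]
    abel

theorem isUnit_sub (h : IsFittingIdempotent a p) : IsUnit (1 - a * (1 - p)) := by
  obtain ⟨N, hN⟩ := h.nil
  refine IsNilpotent.isUnit_one_sub ⟨N + 1, ?_⟩
  have hc : Commute a (1 - p) := (Commute.one_right a).sub_right h.comm.symm
  rw [hc.mul_pow, pow_succ' (1 - p), pow_succ' a, mul_assoc, ← mul_assoc (a ^ N), hN]
  simp

end IsFittingIdempotent

/-- Both units are themselves idempotent, hence equal to `1`; so `e * p = p` and `e * (1 - p) = 0`.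
-/
theorem eq_of_idempotent_of_isUnit {e p : R} (he : e * e = e) (hp : p * p = p)
    (hc : Commute p e) (h₁ : IsUnit (e * p + (1 - p))) (h₂ : IsUnit (1 - e * (1 - p))) :
    e = p := by
  have i₁ : IsIdempotentElem (e * p) := IsIdempotentElem.mul_of_commute hc.symm he hp
  have i₂ : IsIdempotentElem (e * (1 - p)) :=
    IsIdempotentElem.mul_of_commute ((Commute.one_right e).sub_right hc.symm) he
      (IsIdempotentElem.one_sub hp)
  have e₁ : e * p + (1 - p) = 1 := (IsIdempotentElem.iff_eq_one_of_isUnit h₁).1 (by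
    have a₁ : e * p * p = e * p := by rw [mul_assoc, hp]
    have a₂ : p * (e * p) = e * p := by rw [← mul_assoc, hc.eq, mul_assoc, hp]
    have a₃ := i₁.eq
    unfold IsIdempotentElem
    simp only [add_mul, mul_add, mul_sub, sub_mul, mul_one, one_mul, a₁, a₂, a₃, hp]
    abel)
  have e₂ : 1 - e * (1 - p) = 1 := (IsIdempotentElem.iff_eq_one_of_isUnit h₂).1 i₂.one_sub
  have e₃ : e * p = p := by
    rwa [add_sub_left_comm, add_eq_left, sub_eq_zero] at e₁
  have e₄ : e = e * p := by
    rwa [sub_eq_self, mul_sub, mul_one, sub_eq_zero] at e₂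
  rw [e₄, e₃]

end FittingIdempotent

/-! ### Lifting idempotents from the homotopy category to complexes -/

section Complexes

theorem pow_comp_eq_comp_pow {C : Type*} [Category* C] {X Y : C} {a : End X} {b : End Y} {d : X ⟶ Y}
    (h : (a : X ⟶ X) ≫ d = d ≫ (b : Y ⟶ Y)) (n : ℕ) :
    ((a ^ n : End X) : X ⟶ X) ≫ d = d ≫ ((b ^ n : End Y) : Y ⟶ Y) := by
  induction n with
  | zero => simp [End.one_def]
  | succ n ih =>
    rw [pow_succ, pow_succ, End.mul_def, End.mul_def, Category.assoc, ih, ← Category.assoc, h,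
      Category.assoc]

variable {C : Type*} [Category* C] [Preadditive C]

/-- The off-diagonal blocks of `d` vanish. The idempotent on one side is a multiple of an
arbitrarily high power of its endomorphism; moved across `d`, that power kills the complementary
idempotent on the other side. -/
theorem IsFittingIdempotent.naturality {X Y : C} {a p : End X} {b q : End Y}
    (hp : IsFittingIdempotent a p) (hq : IsFittingIdempotent b q) {d : X ⟶ Y}
    (h : (a : X ⟶ X) ≫ d = d ≫ (b : Y ⟶ Y)) :
    (p : X ⟶ X) ≫ d = d ≫ (q : Y ⟶ Y) := by
  have h₁ : (p : X ⟶ X) ≫ d ≫ ((1 - q : End Y) : Y ⟶ Y) = 0 := by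
    obtain ⟨N, hN⟩ := hq.nil
    obtain ⟨x, hx, hxp⟩ := hp.exists_pow_mul N
    rw [← hxp, hx.eq, End.mul_def, Category.assoc, ← Category.assoc _ d, pow_comp_eq_comp_pow h,
      Category.assoc]
    have hc : Commute (b ^ N) (1 - q) :=
      (Commute.one_right _).sub_right (hq.comm.symm.pow_left N)
    rw [← End.mul_def, ← hc.eq, hN]
    simp
  have h₂ : ((1 - p : End X) : X ⟶ X) ≫ d ≫ (q : Y ⟶ Y) = 0 := by
    obtain ⟨N, hN⟩ := hp.nil
    obtain ⟨x, hx, hxp⟩ := hq.exists_pow_mul N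
    rw [← hxp, End.mul_def, ← Category.assoc d, ← pow_comp_eq_comp_pow h, ← Category.assoc,
      ← Category.assoc, ← End.mul_def, hN]
    simp
  have e₁ : (p : X ⟶ X) ≫ d = p ≫ d ≫ q := by
    rw [Preadditive.comp_sub, Preadditive.comp_sub, End.one_def, Category.comp_id] at h₁
    exact sub_eq_zero.1 h₁
  have e₂ : d ≫ q = (p : X ⟶ X) ≫ d ≫ q := by
    rw [Preadditive.sub_comp, End.one_def, Category.id_comp] at h₂
    exact sub_eq_zero.1 h₂
  rw [e₁, ← e₂]

variable {ι : Type*} {c : ComplexShape ι}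

theorem HomologicalComplex.exists_fitting
    (hC : ∀ (X : C) (a : End X), IsStronglyPiRegular a)
    (E : HomologicalComplex C c) (a : End E) :
    ∃ p : End E, p * p = p ∧ Commute p a ∧ IsUnit (a * p + (1 - p)) ∧
      IsUnit (1 - a * (1 - p)) := by
  choose p hp using fun i => (hC (E.X i) (a.f i)).exists_isFittingIdempotent
  let P : End E := HomologicalComplex.Hom.mk (fun i => p i) fun i j _ =>
    (hp i).naturality (hp j) (a.comm i j)
  refine ⟨P, ?_, ?_, ?_, ?_⟩
  · exact HomologicalComplex.Hom.ext (funext fun i => (hp i).idem)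
  · exact HomologicalComplex.Hom.ext (funext fun i => (hp i).comm.eq)
  · rw [isUnit_iff_isIso]
    have : ∀ i, IsIso (HomologicalComplex.Hom.f (a * P + (1 - P)) i) := fun i =>
      (isUnit_iff_isIso _).1 (hp i).isUnit_add
    exact HomologicalComplex.Hom.isIso_of_components _
  · rw [isUnit_iff_isIso]
    have : ∀ i, IsIso (HomologicalComplex.Hom.f (1 - a * (1 - P)) i) := fun i =>
      (isUnit_iff_isIso _).1 (hp i).isUnit_sub
    exact HomologicalComplex.Hom.isIso_of_components _

/-- If every endomorphism in an idempotent complete preadditive category is strongly `π`-regular,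
then idempotents split in its unbounded homotopy category. -/
theorem HomotopyCategory.exists_splitting [IsIdempotentComplete C]
    (hC : ∀ (X : C) (a : End X), IsStronglyPiRegular a)
    (E : HomotopyCategory C c) (e : E ⟶ E) (he : e ≫ e = e) :
    ∃ (F : HomotopyCategory C c) (i : F ⟶ E) (p : E ⟶ F), i ≫ p = 𝟙 F ∧ p ≫ i = e := by
  obtain ⟨E, rfl⟩ := HomotopyCategory.quotient_obj_surjective E
  obtain ⟨a, rfl⟩ := (HomotopyCategory.quotient C c).map_surjective e
  obtain ⟨p, hpp, hpa, h₁, h₂⟩ := HomologicalComplex.exists_fitting hC E a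
  let q : End E →+* End ((HomotopyCategory.quotient C c).obj E) :=
    { (HomotopyCategory.quotient C c).mapEnd E with
      map_zero' := (HomotopyCategory.quotient C c).map_zero E E
      map_add' := fun _ _ => (HomotopyCategory.quotient C c).map_add }
  have key : q a = q p := by
    apply eq_of_idempotent_of_isUnit (e := q a) he
    · rw [← map_mul, hpp]
    · exact hpa.map q
    · have := h₁.map q
      rwa [map_add, map_sub, map_mul, map_one] at this
    · have := h₂.map q
      rwa [map_sub, map_mul, map_sub, map_one] at this
  -- The splitting takes place among complexes, where `p` is strictly idempotent.
  obtain ⟨F, i, r, hir, hri⟩ := IsIdempotentComplete.idempotents_split E p hpp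
  refine ⟨(HomotopyCategory.quotient C c).obj F, (HomotopyCategory.quotient C c).map i,
    (HomotopyCategory.quotient C c).map r, ?_, ?_⟩
  · rw [← Functor.map_comp, hir, CategoryTheory.Functor.map_id]
  · rw [← Functor.map_comp, hri]
    exact key.symm

end Complexes

/-! ### Vector bundles through local bases of sections -/

namespace NodalCurve

open Scheme.Modules Opposite

/-- A finite family `b` of sections of `M` over `U` is a local basis if it restricts to a basis of
the sections of `M` over every open subset of `U`. -/
def IsLocalBasis {Y : Scheme.{u}} (M : Y.Modules) {U : Y.Opens} {ι : Type*} [Fintype ι]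
    (b : ι → Γ(M, U)) : Prop :=
  ∀ (W : Y.Opens) (h : W ≤ U), Function.Bijective fun a : ι → Γ(Y, W) =>
    ∑ i, a i • M.presheaf.map (homOfLE h).op (b i)

section Free

variable (X : Scheme.{u}) (I : Type u)

/-- The structure sheaf, as a module over itself. -/
noncomputable abbrev unitModule : X.Modules := SheafOfModules.unit X.ringCatSheaf

/-- The free module on `I`. -/
noncomputable abbrev freeModule : X.Modules := SheafOfModules.free (R := X.ringCatSheaf) I

variable {X I}

/-- The inclusion of a summand of a free module. -/
noncomputable def freeι (i : I) : unitModule X ⟶ freeModule X I :=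
  SheafOfModules.ιFree (R := X.ringCatSheaf) i

/-- The morphism from a free module with given components. -/
noncomputable def freeDesc {M : X.Modules} (s : I → (unitModule X ⟶ M)) : freeModule X I ⟶ M :=
  Limits.Cofan.IsColimit.desc (SheafOfModules.isColimitFreeCofan (R := X.ringCatSheaf) I) s

theorem freeι_desc {M : X.Modules} (s : I → (unitModule X ⟶ M)) (i : I) :
    freeι i ≫ freeDesc s = s i :=
  Limits.Cofan.IsColimit.fac (SheafOfModules.isColimitFreeCofan (R := X.ringCatSheaf) I) s i

theorem freeModule_hom_ext {M : X.Modules} {f g : freeModule X I ⟶ M}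
    (h : ∀ i, freeι i ≫ f = freeι i ≫ g) : f = g :=
  Limits.Cofan.IsColimit.hom_ext (SheafOfModules.isColimitFreeCofan (R := X.ringCatSheaf) I) _ _ h

/-- The section `1` of the structure sheaf. -/
def oneSection (U : X.Opens) : Γ(unitModule X, U) := (1 : Γ(X, U))

theorem smul_oneSection {U : X.Opens} (x : Γ(X, U)) :
    x • oneSection U = (show Γ(unitModule X, U) from x) :=
  mul_one (show Γ(X, U) from x)

theorem map_oneSection {U V : X.Opens} (h : V ≤ U) :
    (unitModule X).presheaf.map (homOfLE h).op (oneSection U) = oneSection V :=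
  map_one (X.presheaf.map (homOfLE h).op).hom

theorem map_app {M N : X.Modules} (f : M ⟶ N) {U V : X.Opens} (h : V ≤ U) (x : Γ(M, U)) :
    N.presheaf.map (homOfLE h).op (f.app U x) = f.app V (M.presheaf.map (homOfLE h).op x) :=
  (congr($((f.mapPresheaf).naturality (homOfLE h).op) x)).symm

theorem sum_app {M N : X.Modules} {J : Type*} (s : Finset J) (f : J → (M ⟶ N)) {U : X.Opens}
    (x : Γ(M, U)) : (∑ j ∈ s, f j).app U x = ∑ j ∈ s, (f j).app U x := by
  classical
  induction s using Finset.induction_on with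
  | empty => simp
  | insert a s ha ih => simp [Finset.sum_insert ha, ih]

variable [Fintype I]

/-- The coordinate projections `π j` provide the inverse, since `∑ j, π j ≫ freeι j` is the identity
for finite `I`. -/
theorem isLocalBasis_free :
    IsLocalBasis (freeModule X I) (U := ⊤) fun i => (freeι i).app ⊤ (oneSection ⊤) := by
  classical
  let π (j : I) : freeModule X I ⟶ unitModule X := freeDesc fun i => if i = j then 𝟙 _ else 0
  have hπ (i j : I) : freeι i ≫ π j = if i = j then 𝟙 _ else 0 := freeι_desc _ _
  have hsum : ∑ j, π j ≫ freeι j = 𝟙 (freeModule X I) := by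
    refine freeModule_hom_ext fun i => ?_
    simp [Preadditive.comp_sum, ← Category.assoc, hπ, ite_comp]
  intro W h
  have hb (i : I) (a : Γ(X, W)) : a • (freeModule X I).presheaf.map (homOfLE h).op
      ((freeι i).app ⊤ (oneSection ⊤)) = (freeι i).app W (show Γ(unitModule X, W) from a) := by
    rw [map_app, map_oneSection, ← Hom.app_smul, smul_oneSection]
  simp only [hb]
  refine Function.bijective_iff_has_inverse.2 ⟨fun x i => (π i).app W x, fun a => ?_, fun x => ?_⟩
  · funext j
    have (i : I) : (π j).app W ((freeι i).app W (show Γ(unitModule X, W) from a i)) =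
        (if i = j then (a i : Γ(unitModule X, W)) else 0) := by
      rw [← ConcreteCategory.comp_apply, ← Hom.comp_app, hπ]
      split_ifs <;> rfl
    refine (map_sum ((π j).app W).hom (fun i => (freeι i).app W (show Γ(unitModule X, W) from a i))
      Finset.univ).trans ((Finset.sum_congr rfl fun i _ => this i).trans ?_)
    exact Finset.sum_ite_eq' Finset.univ j _ |>.trans (if_pos (Finset.mem_univ j))
  · have := congr(Hom.app $hsum W x)
    rw [sum_app] at this
    exact this

end Free

section LocalBasis

variable {Y : Scheme.{u}} {M N : Y.Modules} {U V : Y.Opens} {ι : Type*} [Fintype ι]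

theorem presheaf_map_map (M : Y.Modules) {U V W : Y.Opens} (h : V ≤ U) (h' : W ≤ V) (x : Γ(M, U)) :
    M.presheaf.map (homOfLE h').op (M.presheaf.map (homOfLE h).op x) =
      M.presheaf.map (homOfLE (h'.trans h)).op x := by
  rw [← ConcreteCategory.comp_apply, ← Functor.map_comp]
  rfl

theorem IsLocalBasis.restrict {b : ι → Γ(M, U)} (hb : IsLocalBasis M b) (h : V ≤ U) :
    IsLocalBasis M fun i => M.presheaf.map (homOfLE h).op (b i) := by
  intro W hW
  simp only [presheaf_map_map]
  exact hb W (hW.trans h)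

theorem IsLocalBasis.map {b : ι → Γ(M, U)} (hb : IsLocalBasis M b) (f : M ⟶ N) [IsIso f] :
    IsLocalBasis N fun i => f.app U (b i) := by
  intro W hW
  have : Function.Bijective (f.app W) := ConcreteCategory.bijective_of_isIso (f.app W)
  convert this.comp (hb W hW) using 1
  funext a
  simp [map_app, map_sum]

theorem IsLocalBasis.reindex {b : ι → Γ(M, U)} (hb : IsLocalBasis M b) {κ : Type*} [Fintype κ]
    (e : κ ≃ ι) : IsLocalBasis M (b ∘ e) := by
  intro W hW
  convert (hb W hW).comp (e.arrowCongr (Equiv.refl Γ(Y, W))).bijective using 1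
  funext a
  refine Fintype.sum_equiv e _ _ fun i => ?_
  simp

theorem restrict_smul (W : U.toScheme.Opens) (r : Γ(U, W)) (x : Γ(M, U.ι ''ᵁ W)) :
    (r • (show Γ(M.restrict U.ι, W) from x) : Γ(M.restrict U.ι, W)) =
      ((show Γ(Y, U.ι ''ᵁ W) from r) • x : Γ(M, U.ι ''ᵁ W)) := by
  change (U.ι.appIso W).inv r • x = _
  rw [Scheme.Opens.ι_appIso]
  rfl

theorem isLocalBasis_restrict_iff {b : ι → Γ(M, U.ι ''ᵁ ⊤)} :
    IsLocalBasis (M.restrict U.ι) (U := ⊤) b ↔ IsLocalBasis M b := by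
  constructor
  · intro hb W hW
    have hW' : U.ι ''ᵁ (U.ι ⁻¹ᵁ W) = W := by
      simpa [Scheme.Hom.image_preimage_eq_opensRange_inf] using hW
    -- Once `W` is literally the image of an open of `U`, sections over the two agree
    -- definitionally.
    generalize U.ι ⁻¹ᵁ W = W' at hW'
    subst hW'
    exact (congrArg Function.Bijective (funext fun a => Finset.sum_congr rfl fun i _ =>
      restrict_smul W' (a i) (M.presheaf.map (homOfLE hW).op (b i)))).mp (hb W' le_top)
  · intro hb W hW
    have hW' : U.ι ''ᵁ W ≤ U.ι ''ᵁ ⊤ := Scheme.Hom.image_mono _ hW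
    exact (congrArg Function.Bijective (funext fun a => Finset.sum_congr rfl fun i _ =>
      restrict_smul W (a i) (M.presheaf.map (homOfLE hW').op (b i)))).mpr (hb (U.ι ''ᵁ W) hW')

/-- The morphism from the structure sheaf given by a global section. -/
noncomputable def unitHom (s : Γ(M, ⊤)) : unitModule Y ⟶ M :=
  (SheafOfModules.unitHomEquiv (R := Y.ringCatSheaf) M).symm
    (PresheafOfModules.sectionsMk (M := M.val)
      (fun W => M.presheaf.map (homOfLE (le_top : W.unop ≤ ⊤)).op s)
      fun _ _ f => presheaf_map_map M le_top f.unop.le s)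

theorem unitHom_app_oneSection (s : Γ(M, ⊤)) (W : Y.Opens) :
    (unitHom s).app W (oneSection W) = M.presheaf.map (homOfLE le_top).op s := by
  have := congr(($((SheafOfModules.unitHomEquiv (R := Y.ringCatSheaf) M).apply_symm_apply
    (PresheafOfModules.sectionsMk (M := M.val)
      (fun W => M.presheaf.map (homOfLE (le_top : W.unop ≤ ⊤)).op s)
      fun _ _ f => presheaf_map_map M le_top f.unop.le s))).val (op W))
  exact this

theorem IsLocalBasis.isIso_freeDesc {ι : Type u} [Fintype ι] {b : ι → Γ(M, ⊤)}
    (hb : IsLocalBasis M b) : IsIso (freeDesc fun i => unitHom (b i)) := by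
  rw [Hom.isIso_iff_isIso_app]
  intro W
  rw [ConcreteCategory.isIso_iff_bijective]
  refine (Function.Bijective.of_comp_iff _ (isLocalBasis_free W le_top)).1 ?_
  convert hb W le_top using 1
  funext a
  have (i : ι) : (freeDesc fun i => unitHom (b i)).app W ((freeι i).app W (oneSection W)) =
      M.presheaf.map (homOfLE le_top).op (b i) := by
    rw [← ConcreteCategory.comp_apply, ← Hom.comp_app, freeι_desc, unitHom_app_oneSection]
  simp only [Function.comp_apply, map_sum, Hom.app_smul, map_app, map_oneSection, this]

theorem exists_isLocalBasis_of_iso {n : ℕ}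
    (e : M.restrict U.ι ≅ freeModule U (ULift.{u} (Fin n))) :
    ∃ b : Fin n → Γ(M, U), IsLocalBasis M b := by
  have h := isLocalBasis_restrict_iff.1 ((isLocalBasis_free (X := U)
    (I := ULift.{u} (Fin n))).map e.inv)
  exact ⟨_, (h.restrict (V := U) (by simp)).reindex Equiv.ulift.symm⟩

theorem IsLocalBasis.nonempty_iso {b : ι → Γ(M, U)} (hb : IsLocalBasis M b) :
    Nonempty (M.restrict U.ι ≅ freeModule U (ULift.{u} (Fin (Fintype.card ι)))) := by
  have h := isLocalBasis_restrict_iff.2 ((hb.reindex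
    (Equiv.ulift.trans (Fintype.equivFin ι).symm)).restrict (V := U.ι ''ᵁ ⊤) (by simp))
  exact ⟨(@asIso _ _ _ _ _ h.isIso_freeDesc).symm⟩

/-- This turns local freeness into linear algebra on sections. -/
theorem isVectorBundle_iff_exists_isLocalBasis :
    isVectorBundle Y M ↔ ∀ y : Y, ∃ (U : Y.Opens) (n : ℕ) (b : Fin n → Γ(M, U)),
      y ∈ U ∧ IsLocalBasis M b := by
  refine forall_congr' fun y => ⟨?_, ?_⟩
  · rintro ⟨U, n, hy, ⟨e⟩⟩
    obtain ⟨b, hb⟩ := exists_isLocalBasis_of_iso e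
    exact ⟨U, n, b, hy, hb⟩
  · rintro ⟨U, n, b, hy, hb⟩
    exact ⟨U, _, hy, hb.nonempty_iso⟩

end LocalBasis

end NodalCurve

/-! ### Retracts of vector bundles -/

namespace NodalCurve

open Scheme.Modules Opposite

section Retract

variable {Y : Scheme.{u}} {M N : Y.Modules} {U V : Y.Opens} {ι : Type*} [Fintype ι]

/-- The basis of `Γ(M, W)` given by the restriction of a local basis. -/
noncomputable def IsLocalBasis.basis {b : ι → Γ(M, U)} (hb : IsLocalBasis M b) {W : Y.Opens}
    (hW : W ≤ U) : Module.Basis ι Γ(Y, W) Γ(M, W) :=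
  .ofEquivFun (LinearEquiv.ofBijective (Fintype.linearCombination Γ(Y, W)
    fun i => M.presheaf.map (homOfLE hW).op (b i)) (hb W hW)).symm

theorem IsLocalBasis.basis_apply {b : ι → Γ(M, U)} (hb : IsLocalBasis M b) {W : Y.Opens}
    (hW : W ≤ U) (i : ι) : hb.basis hW i = M.presheaf.map (homOfLE hW).op (b i) := by
  classical
  rw [basis, Module.Basis.coe_ofEquivFun]
  exact (Fintype.linearCombination_apply_single _ _ i 1).trans (one_smul _ _)

theorem presheaf_map_self (M : Y.Modules) (x : Γ(M, U)) :
    M.presheaf.map (homOfLE (le_refl U)).op x = x := by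
  change M.presheaf.map (𝟙 _) x = x
  simp

theorem IsLocalBasis.map_eq_sum {b : ι → Γ(M, U)} (hb : IsLocalBasis M b) {W : Y.Opens}
    (hW : W ≤ U) (x : Γ(M, U)) : M.presheaf.map (homOfLE hW).op x =
      ∑ j, Y.presheaf.map (homOfLE hW).op ((hb.basis le_rfl).repr x j) •
        M.presheaf.map (homOfLE hW).op (b j) := by
  conv_lhs => rw [← (hb.basis le_rfl).sum_repr x]
  simp [map_sum, hb.basis_apply]

/-- The matrix expressing `v` in the basis `b` becomes invertible where its determinant does. -/
theorem IsLocalBasis.of_det [DecidableEq ι] {b : ι → Γ(M, U)} (hb : IsLocalBasis M b)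
    (v : ι → Γ(M, U)) :
    IsLocalBasis M (U := Y.basicOpen
        (Matrix.det (Matrix.of fun i j => (hb.basis le_rfl).repr (v i) j)))
      fun i => M.presheaf.map (homOfLE (Y.basicOpen_le _)).op (v i) := by
  intro W hW
  set A : Matrix ι ι Γ(Y, U) := Matrix.of fun i j => (hb.basis le_rfl).repr (v i) j with hA
  have hWU : W ≤ U := hW.trans (Y.basicOpen_le _)
  let ρ : Γ(Y, U) →+* Γ(Y, W) := (Y.presheaf.map (homOfLE hWU).op).hom
  have hu : IsUnit (A.map ρ) := by
    rw [Matrix.isUnit_iff_isUnit_det, ← RingHom.mapMatrix_apply, ← RingHom.map_det]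
    have h₁ : IsUnit (Y.presheaf.map (homOfLE (Y.basicOpen_le A.det)).op A.det) :=
      Y.toRingedSpace.isUnit_res_basicOpen A.det
    have h₂ := h₁.map (Y.presheaf.map (homOfLE hW).op).hom
    change IsUnit (Y.presheaf.map (homOfLE hW).op (Y.presheaf.map (homOfLE (Y.basicOpen_le A.det)).op A.det)) at h₂
    rw [← ConcreteCategory.comp_apply, ← Functor.map_comp] at h₂
    exact h₂
  have hbij : Function.Bijective fun a : ι → Γ(Y, W) => Matrix.vecMul a (A.map ρ) := by
    obtain ⟨B, hAB, hBA⟩ := isUnit_iff_exists.1 hu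
    refine Function.bijective_iff_has_inverse.2 ⟨fun a => Matrix.vecMul a B, fun a => ?_,
      fun a => ?_⟩
    · simp [Matrix.vecMul_vecMul, hAB]
    · simp [Matrix.vecMul_vecMul, hBA]
  convert (hb W hWU).comp hbij using 1
  funext a
  simp only [presheaf_map_map, Function.comp_apply, Matrix.vecMul, dotProduct, Finset.sum_smul]
  rw [Finset.sum_comm]
  refine Finset.sum_congr rfl fun i _ => ?_
  rw [hb.map_eq_sum hWU, Finset.smul_sum]
  refine Finset.sum_congr rfl fun j _ => ?_
  rw [smul_smul]
  rfl

/-- Here `v` is adapted to the decomposition of `M` into the image of `i` and the kernel of `p`: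
each member lies in one of them. -/
theorem IsLocalBasis.of_retract {v : ι → Γ(M, U)} (hv : IsLocalBasis M v) (S : ι → Prop)
    [DecidablePred S] (i : N ⟶ M) (p : M ⟶ N) (hip : i ≫ p = 𝟙 N)
    (h₁ : ∀ k, S k → i.app U (p.app U (v k)) = v k) (h₂ : ∀ k, ¬ S k → p.app U (v k) = 0) :
    IsLocalBasis N fun k : {k // S k} => p.app U (v k) := by
  have hipx (W : Y.Opens) (x : Γ(N, W)) : p.app W (i.app W x) = x := congr(Hom.app $hip W x)
  intro W hW
  constructor
  · intro a a' haa
    let ext (a : {k // S k} → Γ(Y, W)) (k : ι) : Γ(Y, W) := if h : S k then a ⟨k, h⟩ else 0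
    have hext (a : {k // S k} → Γ(Y, W)) :
        ∑ k, ext a k • M.presheaf.map (homOfLE hW).op (v k) = i.app W
          (∑ k, a k • N.presheaf.map (homOfLE hW).op (p.app U (v k))) := by
      rw [← Fintype.sum_subtype_add_sum_subtype S, map_sum]
      have e₁ : ∑ k : {k // ¬ S k}, ext a k • M.presheaf.map (homOfLE hW).op (v k) = 0 :=
        Finset.sum_eq_zero fun k _ => by simp [ext, k.2]
      rw [e₁, add_zero]
      refine Finset.sum_congr rfl fun k _ => ?_
      rw [Hom.app_smul, ← map_app, h₁ k k.2]
      simp [ext, k.2]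
    have h := (hv W hW).injective ((hext a).trans ((congrArg _ haa).trans (hext a').symm))
    funext k
    simpa [ext, k.2] using congrFun h k
  · intro x
    obtain ⟨a, ha⟩ := (hv W hW).surjective (i.app W x)
    refine ⟨fun k => a k, ?_⟩
    have h := congrArg (p.app W) ha
    simp only [hipx, map_sum, Hom.app_smul, ← map_app] at h
    rw [← h, ← Fintype.sum_subtype_add_sum_subtype S, left_eq_add]
    refine Finset.sum_eq_zero fun k _ => ?_
    rw [h₂ k k.2, map_zero, smul_zero]

theorem exists_det_ne_zero_of_span_eq_top {K : Type*} [Field K] {n : ℕ} {κ : Type*}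
    (w : κ → Fin n → K) (hw : Submodule.span K (Set.range w) = ⊤) :
    ∃ c : Fin n → κ, (Matrix.of fun i j => w (c i) j).det ≠ 0 := by
  obtain ⟨κ', a, -, hspan, hli⟩ := exists_linearIndependent' K w
  let B : Module.Basis κ' K (Fin n → K) := .mk hli (by rw [hspan, hw])
  let e : Fin n ≃ κ' := (Pi.basisFun K (Fin n)).indexEquiv B
  refine ⟨a ∘ e, ?_⟩
  have := Matrix.linearIndependent_rows_iff_isUnit.1
    (show LinearIndependent K (Matrix.of fun i j => w (a (e i)) j).row from hli.comp e e.injective)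
  exact ((Matrix.isUnit_iff_isUnit_det _).1 this).ne_zero

/-- Projecting a basis to both summands gives vectors spanning the fibre at `y`. Some `n` of them
form a basis of the fibre, hence a local basis near `y`, adapted to the decomposition. -/
theorem isVectorBundle_of_retract (hM : isVectorBundle Y M) (i : N ⟶ M) (p : M ⟶ N)
    (hip : i ≫ p = 𝟙 N) : isVectorBundle Y N := by
  rw [isVectorBundle_iff_exists_isLocalBasis] at hM
  intro y
  obtain ⟨U, n, b, hy, hb⟩ := hM y
  have hipx (W : Y.Opens) (x : Γ(N, W)) : p.app W (i.app W x) = x := congr(Hom.app $hip W x)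
  let w : Fin n ⊕ Fin n → Γ(M, U) :=
    Sum.elim (fun j => i.app U (p.app U (b j))) (fun j => b j - i.app U (p.app U (b j)))
  let ev : Γ(Y, U) →+* Y.residueField y := (Y.evaluation U y hy).hom
  let wy : Fin n ⊕ Fin n → Fin n → Y.residueField y :=
    fun k j => ev ((hb.basis le_rfl).repr (w k) j)
  have hspan : Submodule.span (Y.residueField y) (Set.range wy) = ⊤ := by
    rw [eq_top_iff, ← (Pi.basisFun (Y.residueField y) (Fin n)).span_eq, Submodule.span_le]
    rintro _ ⟨j, rfl⟩
    have : Pi.basisFun (Y.residueField y) (Fin n) j = wy (.inl j) + wy (.inr j) := by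
      funext l
      simp only [wy, w, Sum.elim_inl, Sum.elim_inr, Pi.add_apply, ← map_add, ← Finsupp.add_apply,
        add_sub_cancel]
      have hbj : b j = hb.basis le_rfl j := by rw [hb.basis_apply, presheaf_map_self]
      rw [hbj, Module.Basis.repr_self, Pi.basisFun_apply, Finsupp.single_apply, Pi.single_apply]
      split_ifs with h₁ h₂ h₂
      · exact (map_one ev).symm
      · exact absurd h₁.symm h₂
      · exact absurd h₂.symm h₁
      · exact (map_zero ev).symm
    rw [this]
    exact add_mem (Submodule.subset_span ⟨_, rfl⟩) (Submodule.subset_span ⟨_, rfl⟩)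
  obtain ⟨c, hc⟩ := exists_det_ne_zero_of_span_eq_top wy hspan
  have hv := hb.of_det fun k => w (c k)
  refine ⟨_, _, ?_, (hv.of_retract (fun k => (c k).isLeft) i p hip ?_ ?_).nonempty_iso⟩
  · rw [← Y.evaluation_ne_zero_iff_mem_basicOpen _ hy]
    change ev _ ≠ 0
    rw [RingHom.map_det]
    exact hc
  · intro k hk
    rw [← map_app, ← map_app]
    obtain ⟨j, hj⟩ := Sum.isLeft_iff.1 hk
    simp [hj, w, hipx]
  · intro k hk
    rw [← map_app]
    obtain ⟨j, hj⟩ := Sum.isRight_iff.1 (Sum.not_isLeft.1 hk)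
    simp [hj, w, hipx]

instance (Y : Scheme.{u}) : IsIdempotentComplete (Vect Y) where
  idempotents_split X e he := by
    obtain ⟨N, i, p, hip, hpi⟩ := IsIdempotentComplete.idempotents_split X.obj e.hom
      congr(($he).hom)
    exact ⟨⟨N, isVectorBundle_of_retract X.2 i p hip⟩, ObjectProperty.homMk i,
      ObjectProperty.homMk p, ObjectProperty.hom_ext _ hip, ObjectProperty.hom_ext _ hpi⟩

end Retract

end NodalCurve

/-! ### Monic polynomials and strong `π`-regularity -/

section Polynomial

open Polynomial

/-- A monic polynomial over an integral extension of `k` divides a monic polynomial over `k`. -/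
theorem exists_monic_dvd_map {k A : Type*} [CommRing k] [CommRing A] {ρ : k →+* A}
    (hρ : ρ.IsIntegral) {Q : A[X]} (hQ : Q.Monic) : ∃ P : k[X], P.Monic ∧ Q ∣ P.map ρ := by
  let _ := ρ.toAlgebra
  have : Algebra.IsIntegral k A := ⟨hρ⟩
  -- The root of `Q` is integral over `A`, hence over `k`; its monic equation over `k` is the wanted
  -- multiple of `Q`.
  have h : IsIntegral k (AdjoinRoot.root Q) :=
    isIntegral_trans (R := k) (A := A) _ (AdjoinRoot.isIntegral_root' hQ)
  obtain ⟨P, hP, hPQ⟩ := h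
  refine ⟨P, hP, ?_⟩
  rw [← AdjoinRoot.mk_eq_zero, ← AdjoinRoot.aeval_eq, aeval_def, eval₂_map]
  exact hPQ

/-- Write `P = X ^ m * R` with `R` prime to `X`, and multiply a Bézout relation for `X` and `R` by
`X ^ m`. -/
theorem exists_X_pow_eq {k : Type*} [Field k] {P : k[X]} (hP : P ≠ 0) :
    ∃ (m : ℕ) (u v : k[X]), X ^ m = u * X ^ (m + 1) + v * P := by
  obtain ⟨R, hPR, hR⟩ := exists_eq_pow_rootMultiplicity_mul_and_not_dvd P hP 0
  simp only [map_zero, sub_zero] at hPR hR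
  obtain ⟨a, b, hab⟩ := (irreducible_X.coprime_iff_not_dvd).2 hR
  generalize rootMultiplicity 0 P = m at hPR
  refine ⟨m, a, b, ?_⟩
  conv_lhs => rw [← mul_one (X ^ m), ← hab]
  conv_rhs => rw [hPR]
  ring

theorem isStronglyPiRegular_map_X {k A R : Type*} [Field k] [CommRing A] [Ring R] {ρ : k →+* A}
    (hρ : ρ.IsIntegral) (Φ : A[X] →+* R) {Q : A[X]} (hQ : Q.Monic) (h : Φ Q = 0) :
    IsStronglyPiRegular (Φ X) := by
  obtain ⟨P, hP, hQP⟩ := exists_monic_dvd_map hρ hQ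
  obtain ⟨m, u, v, huv⟩ := exists_X_pow_eq hP.ne_zero
  have hP0 : Φ (P.map ρ) = 0 := by
    obtain ⟨S, hS⟩ := hQP
    rw [hS, map_mul, h, zero_mul]
  refine ⟨m, Φ (u.map ρ), (Commute.all (u.map ρ) X).map Φ, ?_⟩
  have := congrArg (fun p => Φ (p.map ρ)) huv
  simpa [Polynomial.map_mul, hP0] using this

end Polynomial

/-! ### Global Cayley–Hamilton for vector bundles -/

namespace NodalCurve

open Scheme.Modules Opposite Polynomial

variable {Y : Scheme.{u}} {M N : Y.Modules} {U V : Y.Opens}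

theorem hom_ext_of_locally {f g : M ⟶ N}
    (h : ∀ y : Y, ∃ U : Y.Opens, y ∈ U ∧ ∀ W ≤ U, f.app W = g.app W) : f = g := by
  choose U hyU hU using h
  refine Scheme.Modules.hom_ext _ _ fun V => ?_
  ext x
  refine TopCat.Sheaf.eq_of_locally_eq' ⟨N.presheaf, N.isSheaf⟩ (fun y : Y => V ⊓ U y) V
    (fun y => homOfLE inf_le_left) ?_ _ _ fun y => ?_
  · intro y hy
    exact TopologicalSpace.Opens.mem_iSup.2 ⟨y, hy, hyU y⟩
  · change N.presheaf.map (homOfLE _).op _ = N.presheaf.map (homOfLE _).op _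
    rw [map_app, map_app, hU y _ inf_le_right]

/-- The action of the endomorphisms of `M` on the sections over `U`. -/
noncomputable def sectionsEnd (M : Y.Modules) (U : Y.Opens) : End M →+* Module.End Γ(Y, U) Γ(M, U) where
  toFun f :=
    { toFun := Hom.app f U
      map_add' := map_add _
      map_smul' := Hom.app_smul f }
  map_one' := rfl
  map_mul' _ _ := rfl
  map_zero' := rfl
  map_add' _ _ := rfl

theorem sectionsEnd_apply (f : End M) (x : Γ(M, U)) : sectionsEnd M U f x = Hom.app f U x := rfl

theorem structureSheaf_map_map {U V W : Y.Opens} (h : V ≤ U) (h' : W ≤ V) (x : Γ(Y, U)) :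
    Y.presheaf.map (homOfLE h').op (Y.presheaf.map (homOfLE h).op x) =
      Y.presheaf.map (homOfLE (h'.trans h)).op x := by
  rw [← ConcreteCategory.comp_apply, ← Functor.map_comp]
  rfl

/-- Multiplication by a global function, as an endomorphism of a sheaf of modules. -/
noncomputable def scalarHom (M : Y.Modules) (r : Γ(Y, ⊤)) : M ⟶ M where
  val := PresheafOfModules.homMk
    { app := fun W => M.smul (Y.presheaf.map (homOfLE (le_top : W.unop ≤ ⊤)).op r)
      naturality := fun W W' g => by
        have := map_comp_smul (M := M) (homOfLE g.unop.le)
          (Y.presheaf.map (homOfLE (le_top : W.unop ≤ ⊤)).op r)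
        rw [structureSheaf_map_map le_top g.unop.le] at this
        exact this.symm }
    fun W s x => smul_comm (M := Γ(Y, W.unop)) (N := Γ(Y, W.unop)) (α := Γ(M, W.unop)) _ s x

theorem scalarHom_app (r : Γ(Y, ⊤)) (x : Γ(M, U)) :
    (scalarHom M r).app U x = Y.presheaf.map (homOfLE (le_top : U ≤ ⊤)).op r • x := rfl

/-- Global functions act on sheaves of modules. -/
noncomputable def scalarEnd (M : Y.Modules) : Γ(Y, ⊤) →+* End M where
  toFun := scalarHom M
  map_one' := Scheme.Modules.hom_ext _ _ fun U => by ext x; simp [scalarHom_app]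
  map_mul' r s := Scheme.Modules.hom_ext _ _ fun U => by
    rw [mul_comm]; ext x; simp [scalarHom_app, mul_smul]
  map_zero' := Scheme.Modules.hom_ext _ _ fun U => by ext x; simp [scalarHom_app]
  map_add' r s := Scheme.Modules.hom_ext _ _ fun U => by
    ext x
    rw [Hom.add_app]
    change (scalarHom M (r + s)).app U x = (scalarHom M r).app U x + (scalarHom M s).app U x
    simp [scalarHom_app, add_smul]

theorem commute_scalarEnd (r : Γ(Y, ⊤)) (f : End M) : Commute (scalarEnd M r) f :=
  Scheme.Modules.hom_ext _ _ fun _ => by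
    ext x; exact (Hom.app_smul (M := M) f _ x).symm

/-- Evaluation of polynomials over the global functions at an endomorphism. -/
noncomputable def evalEnd (f : End M) : Γ(Y, ⊤)[X] →+* End M :=
  eval₂RingHom' (scalarEnd M) f fun r => commute_scalarEnd r f

theorem evalEnd_X (f : End M) : evalEnd f X = f := eval₂_X _ _

theorem sectionsEnd_evalEnd (f : End M) (p : Γ(Y, ⊤)[X]) :
    sectionsEnd M U (evalEnd f p) = aeval (sectionsEnd M U f)
      (p.map (Y.presheaf.map (homOfLE (le_top : U ≤ ⊤)).op).hom) := by
  rw [aeval_def, eval₂_map]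
  exact hom_eval₂ p (scalarEnd M) (sectionsEnd M U) f

section Charpoly

variable {ι κ : Type*} [Fintype ι] [Fintype κ]

theorem IsLocalBasis.card_eq {b : ι → Γ(M, U)} (hb : IsLocalBasis M b) {c : κ → Γ(M, V)}
    (hc : IsLocalBasis M c) {W : Y.Opens} (hW : W ≤ U) (hW' : W ≤ V) [Nontrivial Γ(Y, W)] :
    Fintype.card ι = Fintype.card κ :=
  Fintype.card_congr ((hb.basis hW).indexEquiv (hc.basis hW'))

variable [DecidableEq ι] [DecidableEq κ]

/-- The characteristic polynomial of an endomorphism with respect to a local basis. -/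
noncomputable def IsLocalBasis.charpoly {b : ι → Γ(M, U)} (hb : IsLocalBasis M b) (f : End M)
    {W : Y.Opens} (hW : W ≤ U) : Γ(Y, W)[X] :=
  (LinearMap.toMatrix (hb.basis hW) (hb.basis hW) (sectionsEnd M W f)).charpoly

theorem IsLocalBasis.charpoly_eq {b : ι → Γ(M, U)} (hb : IsLocalBasis M b) {c : κ → Γ(M, V)}
    (hc : IsLocalBasis M c) (f : End M) {W : Y.Opens} (hW : W ≤ U) (hW' : W ≤ V) :
    hb.charpoly f hW = hc.charpoly f hW' := by
  have := Module.Free.of_basis (hb.basis hW)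
  have := Module.Finite.of_basis (hb.basis hW)
  rw [charpoly, charpoly, LinearMap.charpoly_toMatrix, LinearMap.charpoly_toMatrix]

theorem IsLocalBasis.aeval_charpoly {b : ι → Γ(M, U)} (hb : IsLocalBasis M b) (f : End M)
    {W : Y.Opens} (hW : W ≤ U) : aeval (sectionsEnd M W f) (hb.charpoly f hW) = 0 := by
  have := Module.Free.of_basis (hb.basis hW)
  have := Module.Finite.of_basis (hb.basis hW)
  rw [charpoly, LinearMap.charpoly_toMatrix, LinearMap.aeval_self_charpoly]

theorem IsLocalBasis.charpoly_map {b : ι → Γ(M, U)} (hb : IsLocalBasis M b) (f : End M)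
    {W : Y.Opens} (hW : W ≤ U) :
    (hb.charpoly f le_rfl).map (Y.presheaf.map (homOfLE hW).op).hom = hb.charpoly f hW := by
  rw [charpoly, ← Matrix.charpoly_map]
  congr 1
  ext i j
  rw [Matrix.map_apply, LinearMap.toMatrix_apply, LinearMap.toMatrix_apply, hb.basis_apply,
    hb.basis_apply, presheaf_map_self, sectionsEnd_apply, sectionsEnd_apply, ← map_app,
    hb.map_eq_sum hW]
  simp only [← hb.basis_apply]
  rw [Module.Basis.repr_sum_self]

theorem IsLocalBasis.charpoly_monic {b : ι → Γ(M, U)} (hb : IsLocalBasis M b) (f : End M) :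
    (hb.charpoly f le_rfl).Monic := Matrix.charpoly_monic _

theorem IsLocalBasis.charpoly_natDegree [Nontrivial Γ(Y, U)] {b : ι → Γ(M, U)}
    (hb : IsLocalBasis M b) (f : End M) :
    (hb.charpoly f le_rfl).natDegree = Fintype.card ι := Matrix.charpoly_natDegree_eq_dim _

end Charpoly

/-- An endomorphism of a vector bundle on a quasi-compact scheme is a root of a monic polynomial
with global functions as coefficients. -/
theorem exists_monic_evalEnd_eq_zero [CompactSpace Y] (hM : isVectorBundle Y M) (f : End M) :
    ∃ Q : Γ(Y, ⊤)[X], Q.Monic ∧ evalEnd f Q = 0 := by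
  rw [isVectorBundle_iff_exists_isLocalBasis] at hM
  choose U n b hyU hb using hM
  obtain ⟨t, ht⟩ := CompactSpace.elim_nhds_subcover (fun y => (U y : Set Y))
    fun y => (U y).isOpen.mem_nhds (hyU y)
  set N := t.sup n
  have hN (i : t) : N - n i + n i = N := Nat.sub_add_cancel (Finset.le_sup i.2)
  -- The rank may vary over `Y`; padding by a power of `X` gives the characteristic polynomials the
  -- common degree `N`, so they glue to a monic polynomial.
  let Q (i : t) : Γ(Y, U i)[X] := X ^ (N - n i) * (hb i).charpoly f le_rfl
  have hQm (i : t) : (Q i).Monic := (monic_X_pow _).mul ((hb i).charpoly_monic f)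
  have hQmap (i : t) {W : Y.Opens} (hW : W ≤ U i) :
      (Q i).map (Y.presheaf.map (homOfLE hW).op).hom =
        X ^ (N - n i) * (hb i).charpoly f hW := by
    simp [Q, Polynomial.map_mul, (hb i).charpoly_map f hW]
  have hcompat (i j : t) {W : Y.Opens} (hi : W ≤ U i) (hj : W ≤ U j) :
      (Q i).map (Y.presheaf.map (homOfLE hi).op).hom =
        (Q j).map (Y.presheaf.map (homOfLE hj).op).hom := by
    -- Over a zero ring the ranks need not agree, but all polynomials do.
    rcases subsingleton_or_nontrivial Γ(Y, W) with h | h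
    · exact Subsingleton.elim _ _
    · have : n i = n j := by simpa using (hb i).card_eq (hb j) hi hj
      rw [hQmap, hQmap, (hb i).charpoly_eq (hb j) f hi hj, this]
  have hglue (l : ℕ) : ∃ q : Γ(Y, ⊤), ∀ i : t,
      Y.presheaf.map (homOfLE (le_top : U i ≤ ⊤)).op q = (Q i).coeff l := by
    refine (TopCat.Sheaf.existsUnique_gluing' Y.sheaf (fun i : t => U i) ⊤
      (fun i => homOfLE le_top) ?_ (fun i => (Q i).coeff l) ?_).exists
    · intro y _
      have : y ∈ ⋃ x ∈ t, (U x : Set Y) := ht ▸ Set.mem_univ y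
      simp only [Set.mem_iUnion] at this
      obtain ⟨x, hx, hy⟩ := this
      exact TopologicalSpace.Opens.mem_iSup.2 ⟨⟨x, hx⟩, hy⟩
    · intro i j
      have := congrArg (fun p => p.coeff l) (hcompat i j (W := U i ⊓ U j) inf_le_left inf_le_right)
      simp only [coeff_map] at this
      exact this
  choose q hq using hglue
  -- Only the coefficients below `N` are taken from the gluing; the leading one is put in as `1`.
  let P : Γ(Y, ⊤)[X] := X ^ N + ∑ l ∈ Finset.range N, C (q l) * X ^ l
  have hP (i : t) : P.map (Y.presheaf.map (homOfLE (le_top : U i ≤ ⊤)).op).hom = Q i := by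
    rcases subsingleton_or_nontrivial Γ(Y, U i) with h | h
    · exact Subsingleton.elim _ _
    · have hdeg : (Q i).natDegree = N := by
        rw [(monic_X_pow _).natDegree_mul ((hb i).charpoly_monic f), natDegree_X_pow,
          (hb i).charpoly_natDegree, Fintype.card_fin, hN]
      rw [(hQm i).as_sum, hdeg]
      simp only [P, Polynomial.map_add, Polynomial.map_pow, map_X, Polynomial.map_sum,
        Polynomial.map_mul, map_C]
      congr 1
      exact Finset.sum_congr rfl fun l _ => by rw [← hq l i]
  refine ⟨P, monic_X_pow_add ?_, hom_ext_of_locally fun y => ?_⟩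
  · exact (degree_sum_le _ _).trans_lt ((Finset.sup_lt_iff (WithBot.bot_lt_coe N)).2 fun l hl =>
      (degree_C_mul_X_pow_le l _).trans_lt (Nat.cast_lt.2 (Finset.mem_range.1 hl)))
  · have : y ∈ ⋃ x ∈ t, (U x : Set Y) := ht ▸ Set.mem_univ y
    simp only [Set.mem_iUnion] at this
    obtain ⟨x, hx, hy⟩ := this
    refine ⟨U x, hy, fun W hW => ?_⟩
    have key : sectionsEnd M W (evalEnd f P) = 0 := by
      have hcomp : (Y.presheaf.map (homOfLE (le_top : W ≤ ⊤)).op).hom =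
          (Y.presheaf.map (homOfLE hW).op).hom.comp
            (Y.presheaf.map (homOfLE (le_top : U x ≤ ⊤)).op).hom :=
        RingHom.ext fun r => (structureSheaf_map_map le_top hW r).symm
      rw [sectionsEnd_evalEnd, hcomp, ← Polynomial.map_map, hP ⟨x, hx⟩, hQmap ⟨x, hx⟩ hW, map_mul,
        (hb x).aeval_charpoly, mul_zero]
    ext z
    exact congr($key z)

end NodalCurve

/-! ### Projectivity and conclusion -/

namespace NodalCurve

/-- Universal closedness enters twice: it makes `Y` quasi-compact, so ranks are bounded on a finite
cover, and it makes the global functions integral over `k`. -/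
theorem isStronglyPiRegular_of_universallyClosed {k : Type u} [Field k] {Y : Scheme.{u}}
    (f : Y ⟶ Spec (.of k)) [UniversallyClosed f] (V : Vect Y) (a : End V) :
    IsStronglyPiRegular a := by
  have : CompactSpace Y := (quasiCompact_iff_compactSpace f).mp inferInstance
  let F := (Scheme.ΓSpecIso (.of k)).inv ≫ f.appTop
  have hF : F.hom.IsIntegral := by
    apply RingHom.isIntegral_respectsIso.2 (e := (Scheme.ΓSpecIso _).symm.commRingCatIsoToRingEquiv)
    exact isIntegral_appTop_of_universallyClosed f
  obtain ⟨Q, hQ, hQ0⟩ := exists_monic_evalEnd_eq_zero V.2 a.hom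
  obtain ⟨m, b, hb, hm⟩ := isStronglyPiRegular_map_X hF (evalEnd a.hom) hQ hQ0
  rw [evalEnd_X] at hb hm
  let φ : End V.obj →* End V := ((isVectorBundle Y).fullyFaithfulι.mulEquivEnd V).symm.toMonoidHom
  refine ⟨m, φ b, ?_, ?_⟩
  · exact hb.map φ
  · have := congrArg φ hm
    rwa [map_mul, map_pow, map_pow] at this

section ProjectiveSpace

attribute [local instance] MvPolynomial.gradedAlgebra

theorem bijective_algebraMap_homogeneousSubmodule_zero (k : Type u) [Field k] (n : ℕ) :
    Function.Bijective
      (algebraMap k (MvPolynomial.homogeneousSubmodule (Fin (n + 1)) k 0)) := by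
  refine ⟨fun a b h => MvPolynomial.C_injective _ _ (congrArg Subtype.val h), fun ⟨p, hp⟩ =>
    ⟨p.coeff 0, Subtype.ext ?_⟩⟩
  exact (MvPolynomial.totalDegree_eq_zero_iff_eq_C.1
    (Nat.le_zero.1 (MvPolynomial.IsHomogeneous.totalDegree_le hp))).symm

/-- `Proj` of a finite type graded algebra is universally closed over its degree-zero part, which
here is `k`. -/
instance (k : Type u) [Field k] (n : ℕ) : UniversallyClosed (projSpaceToSpec k n) := by
  have : IsScalarTower k (MvPolynomial.homogeneousSubmodule (Fin (n + 1)) k 0)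
      (MvPolynomial (Fin (n + 1)) k) :=
    ⟨fun a b c => smul_mul_assoc a (b : MvPolynomial (Fin (n + 1)) k) c⟩
  have : Algebra.FiniteType (MvPolynomial.homogeneousSubmodule (Fin (n + 1)) k 0)
      (MvPolynomial (Fin (n + 1)) k) := .of_restrictScalars_finiteType k _ _
  have : IsIso (CommRingCat.ofHom
      (algebraMap k (MvPolynomial.homogeneousSubmodule (Fin (n + 1)) k 0))) :=
    (ConcreteCategory.isIso_iff_bijective _).2
      (bijective_algebraMap_homogeneousSubmodule_zero k n)
  have : UniversallyClosed
      (Proj.toSpecZero (MvPolynomial.homogeneousSubmodule (Fin (n + 1)) k)) := inferInstance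
  exact MorphismProperty.comp_mem @UniversallyClosed _ _ this inferInstance

end ProjectiveSpace

theorem IsProjective.universallyClosed {k : Type u} [Field k] {Y : Scheme.{u}}
    {f : Y ⟶ Spec (.of k)} (hf : IsProjective f) : UniversallyClosed f := by
  obtain ⟨n, i, hi, rfl⟩ := hf
  infer_instance

end NodalCurve

theorem proposition4p6 {k : Type u} [Field k] [IsAlgClosed k] {Y : Scheme.{u}}
    (f : Y ⟶ Spec (.of k)) (hY : NodalCurve.IsProjectiveCurve f)
    (hnodes : NodalCurve.HasOnlySimpleNodes f) :
    ∀ (E : NodalCurve.KVect Y) (e : E ⟶ E), e ≫ e = e →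
      ∃ (F : NodalCurve.KVect Y) (i : F ⟶ E) (p : E ⟶ F), i ≫ p = 𝟙 F ∧ p ≫ i = e := by
  have := hY.isProjective.universallyClosed
  exact HomotopyCategory.exists_splitting
    (NodalCurve.isStronglyPiRegular_of_universallyClosed f)
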